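/- Let $\mathcal G=(\mathcal V,\mathcal E,\mathcal W)$ be a finite connected undirected simple graph with nonzero real edge weights $\mathcal W:\mathcal E\to\mathbb R\setminus\{0\}$, let $E$ be its (oriented) incidence matrix, $W$ the diagonal matrix of the edge weights, and $L(\mathcal G)=EWE^T$ its weighted Laplacian. Assume that $\mathcal G$ contains exactly one cycle, that exactly one edge $e_-=\{u,v\}$ has negative weight, that the graph $\mathcal G_+$ obtained from $\mathcal G$ by deleting $e_-$ is connected, and that $|\mathcal W(e_-)|=\mathcal R_{uv}(\mathcal G_+)^{-1}$, where $\mathcal R_{uv}(\mathcal G_+)=(\mathbf e_u-\mathbf e_v)^TL(\mathcal G_+)^\dagger(\mathbf e_u-\mathbf e_v)$ is the effective resistance between $u$ and $v$ in $\mathcal G_+$ and $\dagger$ denotes the Moore–Penrose pseudo-inverse. Let $\mathcal H$ be the graph obtained from $\mathcal G$ by deleting all edges of the cycle (keeping all nodes), and let $q$ be the number of its connected components. Then for every initial condition $x(0)\in\mathbb R^{\mathcal V}$ the consensus protocol $\dot x(t)=-L(\mathcal G)x(t)$, $t\ge 0$, has a trajectory, and every trajectory converges as $t\to\infty$ to a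 limit $y\in\mathbb R^{\mathcal V}$ which is constant on each connected component of $\mathcal H$. Moreover there is a linear hyperplane $N\subset\mathbb R^{\mathcal V}$ (a subspace of dimension $|\mathcal V|-1$), depending only on $\mathcal G$, such that: - if $x(0)\notin N$, the agents form exactly $q$ clusters, namely the components of $\mathcal H$: $y_i=y_j$ if and only if $i$ and $j$ lie in the same component of $\mathcal H$, so that $y$ takes exactly $q$ distinct values; - if $x(0)\in N$, all agents agree on the average of the initial states: $y_i=\frac1{|\mathcal V|}\sum_{j}x_j(0)$ for every $i$. -/

import Mathlib

/-- An undirected weighted graph: a simple graph with a nonzero real weight, of either sign, on each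
edge. Only the values of `weight` on edges are ever used. -/
structure WeightedGraph (V : Type*) where
  graph : SimpleGraph V
  weight : Sym2 V → ℝ
  weight_ne_zero : ∀ e ∈ graph.edgeSet, weight e ≠ 0

/-- `B` is a Moore–Penrose pseudo-inverse of the real matrix `A`. -/
structure IsMoorePenroseInverse {m n : Type*} [Fintype m] [Fintype n]
    (A : Matrix m n ℝ) (B : Matrix n m ℝ) : Prop where
  mul_mul_self : A * B * A = A
  self_mul_mul : B * A * B = B
  symm_left : (A * B).transpose = A * B
  symm_right : (B * A).transpose = B * A

/-- The Moore–Penrose pseudo-inverse is unique. -/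
theorem IsMoorePenroseInverse.unique {m n : Type*} [Fintype m] [Fintype n]
    {A : Matrix m n ℝ} {B C : Matrix n m ℝ}
    (hB : IsMoorePenroseInverse A B) (hC : IsMoorePenroseInverse A C) : B = C := by
  have h1 : A * B = A * C := by
    calc A * B = (A * C * A) * B := by rw [hC.mul_mul_self]
      _ = (A * C) * (A * B) := by simp only [Matrix.mul_assoc]
      _ = (A * C).transpose * (A * B).transpose := by rw [hC.symm_left, hB.symm_left]
      _ = ((A * B) * (A * C)).transpose := by rw [Matrix.transpose_mul (A * B)]
      _ = ((A * B * A) * C).transpose := by simp only [Matrix.mul_assoc]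
      _ = A * C := by rw [hB.mul_mul_self, hC.symm_left]
  have h2 : B * A = C * A := by
    calc B * A = B * (A * C * A) := by rw [hC.mul_mul_self]
      _ = (B * A) * (C * A) := by simp only [Matrix.mul_assoc]
      _ = (B * A).transpose * (C * A).transpose := by rw [hC.symm_right, hB.symm_right]
      _ = ((C * A) * (B * A)).transpose := by rw [Matrix.transpose_mul (C * A)]
      _ = (C * (A * B * A)).transpose := by simp only [Matrix.mul_assoc]
      _ = C * A := by rw [hB.mul_mul_self, hC.symm_right]
  calc B = B * A * B := hB.self_mul_mul.symm
    _ = C * (A * B) := by rw [h2, Matrix.mul_assoc]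
    _ = C := by rw [h1, ← Matrix.mul_assoc, hC.self_mul_mul]

/-- Every real symmetric matrix has a Moore–Penrose pseudo-inverse. -/
theorem exists_isMoorePenroseInverse {n : Type*} [Fintype n]
    {A : Matrix n n ℝ} (hA : A.IsSymm) : ∃ B, IsMoorePenroseInverse A B := by
  classical
  have hH : A.IsHermitian := by
    rw [Matrix.IsHermitian, Matrix.conjTranspose_eq_transpose_of_trivial]; exact hA
  obtain ⟨U, d, hU, hA'⟩ : ∃ (U : Matrix n n ℝ) (d : n → ℝ),
      U.transpose * U = 1 ∧ A = U * Matrix.diagonal d * U.transpose := by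
    refine ⟨hH.eigenvectorUnitary, hH.eigenvalues, ?_, ?_⟩
    · have := Unitary.coe_star_mul_self hH.eigenvectorUnitary
      rwa [Matrix.star_eq_conjTranspose, Matrix.conjTranspose_eq_transpose_of_trivial] at this
    · have := hH.spectral_theorem
      rw [Unitary.conjStarAlgAut_apply, Matrix.star_eq_conjTranspose,
        Matrix.conjTranspose_eq_transpose_of_trivial] at this
      exact this
  have key : ∀ a b : n → ℝ, (U * Matrix.diagonal a * U.transpose) *
      (U * Matrix.diagonal b * U.transpose) =
        U * Matrix.diagonal (fun i => a i * b i) * U.transpose := by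
    intro a b
    calc _ = U * Matrix.diagonal a * (U.transpose * U) * Matrix.diagonal b * U.transpose := by
          simp only [Matrix.mul_assoc]
      _ = _ := by rw [hU, Matrix.mul_one, Matrix.mul_assoc U, Matrix.diagonal_mul_diagonal]
  have hs : ∀ a : n → ℝ, (U * Matrix.diagonal a * U.transpose).transpose =
      U * Matrix.diagonal a * U.transpose := by
    intro a
    simp [Matrix.transpose_mul, Matrix.mul_assoc]
  refine ⟨U * Matrix.diagonal (fun i => (d i)⁻¹) * U.transpose, ?_, ?_, ?_, ?_⟩
  · rw [hA', key, key]; simp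
  · rw [hA', key, key]
    have : (fun i => (d i)⁻¹ * d i * (d i)⁻¹) = fun i => (d i)⁻¹ := by
      funext i
      by_cases h : d i = 0 <;> simp [h]
    rw [this]
  · rw [hA', key, hs]
  · rw [hA', key, hs]

/-- The Moore–Penrose pseudo-inverse of a real symmetric matrix. -/
noncomputable def moorePenroseInverse {n : Type*} [Fintype n]
    {A : Matrix n n ℝ} (hA : A.IsSymm) : Matrix n n ℝ :=
  (exists_isMoorePenroseInverse hA).choose

/-- `C` is the set of edges of a cycle of `G`. Two cycles are the same subgraph exactly when they
have the same edges, whatever their base points and directions. -/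
def IsCycleEdgeSet {V : Type*} (G : SimpleGraph V) (C : Set (Sym2 V)) : Prop :=
  ∃ (a : V) (p : G.Walk a a), p.IsCycle ∧ p.edgeSet = C

namespace WeightedGraph

variable {V : Type*}

open Classical in
/-- The incidence matrix `E(G)`, for an arbitrary fixed orientation of the edges. -/
noncomputable def incidence (G : WeightedGraph V) : Matrix V G.graph.edgeSet ℝ :=
  Matrix.of fun i e =>
    if i = (Quot.out (e : Sym2 V)).1 then 1 else if i = (Quot.out (e : Sym2 V)).2 then -1 else 0

open Classical in
/-- The weighted Laplacian `L(G) = E W Eᵀ`. -/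
noncomputable def laplacian [Fintype V] (G : WeightedGraph V) : Matrix V V ℝ :=
  G.incidence * Matrix.diagonal (fun e : G.graph.edgeSet => G.weight e) * G.incidence.transpose

theorem laplacian_isSymm [Fintype V] (G : WeightedGraph V) : G.laplacian.IsSymm := by
  simp [Matrix.IsSymm, laplacian, Matrix.transpose_mul, Matrix.mul_assoc]

/-- The spanning subgraph `G₊` obtained by deleting the edges of negative weight. -/
def positivePart (G : WeightedGraph V) : WeightedGraph V where
  graph := G.graph.deleteEdges {e | G.weight e < 0}
  weight := G.weight
  weight_ne_zero := fun e he =>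
    G.weight_ne_zero e (SimpleGraph.edgeSet_mono (SimpleGraph.deleteEdges_le _) he)

/-- The effective resistance `(e_u - e_v)ᵀ L(G)† (e_u - e_v)`. -/
noncomputable def effectiveResistance [Fintype V] (G : WeightedGraph V) (u v : V) : ℝ :=
  let P := moorePenroseInverse G.laplacian_isSymm
  P u u - 2 * P u v + P v v

/-- `x` is a trajectory on `[0, ∞)` of the consensus protocol `ẋ = -L(G) x`. -/
def IsConsensusTrajectory [Fintype V] (G : WeightedGraph V) (x : ℝ → V → ℝ) : Prop :=
  IsIntegralCurveOn x (fun _ y => -(G.laplacian.mulVec y)) (Set.Ici 0)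

end WeightedGraph

/-- The limit configuration `y` of the agents `V` consists of the clusters given by the connected
components of `H`: two agents have the same limit state if and only if they lie in the same
component. -/
def IsClusteredBy {V : Type*} (H : SimpleGraph V) (y : V → ℝ) : Prop :=
  ∀ i j, y i = y j ↔ H.connectedComponentMk i = H.connectedComponentMk j

/-!
Write `b = e_u - e_v` and let `z = L(G₊)† b` be the potential of a unit flow from `u` to `v` in
`G₊`, so that `bᵀ z` is the effective resistance. At the critical weight,
`L(G) = L(G₊) - (bᵀ z)⁻¹ b bᵀ` is a rank-one downdate which stays positive semidefinite, by
Cauchy–Schwarz in the semi-inner product of `L(G₊)`, and whose kernel grows exactly by the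
direction `z`, i.e. it is spanned by the orthogonal vectors `1` and `z`. Hence every trajectory
converges to the orthogonal projection of `x(0)` onto this plane, `N` being the orthogonal
complement of `z`. As `G` has only one cycle, `G₊` is a tree and the unit flow runs along its path
from `u` to `v`: the potential strictly decreases along that path and is equal at the ends of every
other edge, so its level sets are the components left after deleting the cycle.
-/

open Matrix Filter Topology

section LinearFlow

theorem exists_isIntegralCurve_continuousLinearMap {E : Type*} [NormedAddCommGroup E]
    [NormedSpace ℝ E] [CompleteSpace E] (T : E →L[ℝ] E) (x₀ : E) :
    ∃ x : ℝ → E, IsIntegralCurve x (fun _ y => T y) ∧ x 0 = x₀ := by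
  refine ⟨fun t => NormedSpace.exp (t • T) x₀, fun t => ?_, by simp⟩
  simpa using (hasDerivAt_exp_smul_const' T t).clm_apply (hasDerivAt_const t x₀)

theorem eq_exp_mul_of_hasDerivWithinAt {f : ℝ → ℝ} {d : ℝ}
    (hf : ∀ s, 0 ≤ s → HasDerivWithinAt f (-(d * f s)) (Set.Ici 0) s) {t : ℝ} (ht : 0 ≤ t) :
    f t = Real.exp (-(d * t)) * f 0 := by
  have hderiv (s : ℝ) (hs : 0 ≤ s) :
      HasDerivWithinAt (fun s => Real.exp (d * s) * f s) 0 (Set.Ici 0) s := by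
    have hexp := (((hasDerivAt_id s).const_mul d).exp).hasDerivWithinAt (s := Set.Ici 0)
    exact (hexp.mul (hf s hs)).congr_deriv (by simp only [id]; ring)
  have hconst : Real.exp (d * t) * f t = Real.exp (d * 0) * f 0 :=
    constant_of_has_deriv_right_zero
      (fun s hs => (hderiv s hs.1).continuousWithinAt.mono Set.Icc_subset_Ici_self)
      (fun s hs => (hderiv s hs.1).mono (Set.Ici_subset_Ici.2 hs.1)) t ⟨ht, le_rfl⟩
  rw [mul_zero, Real.exp_zero, one_mul] at hconst
  rw [← hconst, ← mul_assoc, ← Real.exp_add, neg_add_cancel, Real.exp_zero, one_mul]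

variable {n : Type*} [Fintype n] {A : Matrix n n ℝ} {x : ℝ → n → ℝ}

theorem mulVec_dotProduct_of_isSymm (hA : A.IsSymm) (y z : n → ℝ) :
    (A *ᵥ y) ⬝ᵥ z = y ⬝ᵥ (A *ᵥ z) := by
  rw [dotProduct_mulVec, ← mulVec_transpose, hA.eq]

theorem dotProduct_eigenvector_of_isIntegralCurveOn (hA : A.IsSymm)
    (hx : IsIntegralCurveOn x (fun _ y => -(A *ᵥ y)) (Set.Ici 0)) {k : n → ℝ} {d : ℝ}
    (hk : A *ᵥ k = d • k) {t : ℝ} (ht : 0 ≤ t) :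
    x t ⬝ᵥ k = Real.exp (-(d * t)) * (x 0 ⬝ᵥ k) := by
  refine eq_exp_mul_of_hasDerivWithinAt (f := fun s => x s ⬝ᵥ k) (fun s hs => ?_) ht
  have hderiv : HasDerivWithinAt (fun s => x s ⬝ᵥ k) (-(A *ᵥ x s) ⬝ᵥ k) (Set.Ici 0) s :=
    HasDerivWithinAt.fun_sum fun i _ => (hasDerivWithinAt_pi.1 (hx s hs) i).mul_const (k i)
  rwa [neg_dotProduct, mulVec_dotProduct_of_isSymm hA, hk, dotProduct_smul] at hderiv

theorem sum_dotProduct_smul_eigenvectorBasis [DecidableEq n] (hA : A.IsHermitian) (w : n → ℝ) :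
    ∑ i, (w ⬝ᵥ hA.eigenvectorBasis i) • ⇑(hA.eigenvectorBasis i) = w := by
  have hrepr := congrArg (WithLp.ofLp) (hA.eigenvectorBasis.sum_repr' (WithLp.toLp 2 w))
  simpa [EuclideanSpace.inner_eq_star_dotProduct] using hrepr

theorem tendsto_of_forall_ker_dotProduct_eq (hA : A.PosSemidef)
    (hx : IsIntegralCurveOn x (fun _ y => -(A *ᵥ y)) (Set.Ici 0)) {y : n → ℝ} (hy : A *ᵥ y = 0)
    (hproj : ∀ k, A *ᵥ k = 0 → y ⬝ᵥ k = x 0 ⬝ᵥ k) : Tendsto x atTop (𝓝 y) := by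
  classical
  have hsymm : A.IsSymm := hA.isHermitian
  set b := hA.isHermitian.eigenvectorBasis
  have hcoord (i : n) : Tendsto (fun t => x t ⬝ᵥ b i) atTop (𝓝 (y ⬝ᵥ b i)) := by
    set d := hA.isHermitian.eigenvalues i
    have heig : A *ᵥ b i = d • ⇑(b i) := hA.isHermitian.mulVec_eigenvectorBasis i
    have hflow : (fun t => Real.exp (-(d * t)) * (x 0 ⬝ᵥ b i)) =ᶠ[atTop] fun t => x t ⬝ᵥ b i := by
      filter_upwards [eventually_ge_atTop 0] with t ht
      exact (dotProduct_eigenvector_of_isIntegralCurveOn hsymm hx heig ht).symm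
    refine Tendsto.congr' hflow ?_
    have hd_nonneg : 0 ≤ d := hA.eigenvalues_nonneg i
    rcases hd_nonneg.eq_or_lt' with hd | hd
    · simp [hd, hproj (b i) (by rw [heig, hd, zero_smul])]
    · have hyb : d * (y ⬝ᵥ b i) = 0 := by
        rw [← smul_eq_mul, ← dotProduct_smul, ← heig, ← mulVec_dotProduct_of_isSymm hsymm, hy,
          zero_dotProduct]
      have hdecay : Tendsto (fun t => Real.exp (-(d * t))) atTop (𝓝 0) :=
        Real.tendsto_exp_neg_atTop_nhds_zero.comp (tendsto_id.const_mul_atTop hd)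
      simpa [(mul_eq_zero.1 hyb).resolve_left hd.ne'] using hdecay.mul_const (x 0 ⬝ᵥ b i)
  simpa only [b, sum_dotProduct_smul_eigenvectorBasis] using
    tendsto_finsetSum Finset.univ fun i _ => (hcoord i).smul_const ⇑(b i)

theorem tendsto_of_ker_eq_span_pair (hA : A.PosSemidef) {e f : n → ℝ} (hef : e ⬝ᵥ f = 0)
    (hker : LinearMap.ker A.mulVecLin = Submodule.span ℝ {e, f})
    (hx : IsIntegralCurveOn x (fun _ y => -(A *ᵥ y)) (Set.Ici 0)) :
    Tendsto x atTop
      (𝓝 ((x 0 ⬝ᵥ e / (e ⬝ᵥ e)) • e + (x 0 ⬝ᵥ f / (f ⬝ᵥ f)) • f)) := by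
  have hmem (k : n → ℝ) : A *ᵥ k = 0 ↔ ∃ α β : ℝ, α • e + β • f = k := by
    rw [← Submodule.mem_span_pair, ← hker, LinearMap.mem_ker, mulVecLin_apply]
  have hcancel (g : n → ℝ) : x 0 ⬝ᵥ g / (g ⬝ᵥ g) * (g ⬝ᵥ g) = x 0 ⬝ᵥ g :=
    div_mul_cancel_of_imp fun hg => by rw [dotProduct_self_eq_zero.1 hg, dotProduct_zero]
  refine tendsto_of_forall_ker_dotProduct_eq hA hx ((hmem _).2 ⟨_, _, rfl⟩) fun k hk => ?_
  obtain ⟨α, β, rfl⟩ := (hmem k).1 hk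
  simp only [add_dotProduct, dotProduct_add, smul_dotProduct, dotProduct_smul, smul_eq_mul, hef,
    dotProduct_comm f e]
  linear_combination α * hcancel e + β * hcancel f

end LinearFlow

section RankOneDowndate

variable {n : Type*} [Fintype n] {A : Matrix n n ℝ} {b z : n → ℝ} {c : ℝ}

theorem sub_smul_vecMulVec_mulVec (hz : A *ᵥ z = b) (c : ℝ) (x : n → ℝ) :
    (A - c • vecMulVec b b) *ᵥ x = A *ᵥ (x - (c * (b ⬝ᵥ x)) • z) := by
  rw [sub_mulVec, smul_mulVec, vecMulVec_mulVec, mulVec_sub, mulVec_smul, hz, mul_smul,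
    op_smul_eq_smul]

theorem posSemidef_sub_smul_vecMulVec (hA : A.PosSemidef) (hz : A *ᵥ z = b)
    (hc : c * (b ⬝ᵥ z) = 1) : (A - c • vecMulVec b b).PosSemidef := by
  have hsymm : A.IsSymm := hA.isHermitian
  refine .of_dotProduct_mulVec_nonneg (hA.isHermitian.sub ?_) fun x => ?_
  · exact IsSymm.ext fun i j => by simp [vecMulVec_apply, mul_comm]
  set w := x - (c * (b ⬝ᵥ x)) • z
  have hzw : z ⬝ᵥ (A *ᵥ w) = 0 := by
    rw [← mulVec_dotProduct_of_isSymm hsymm, hz, dotProduct_sub, dotProduct_smul, smul_eq_mul]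
    linear_combination -(b ⬝ᵥ x) * hc
  have hxw : x ⬝ᵥ (A *ᵥ w) = w ⬝ᵥ (A *ᵥ w) := by
    rw [sub_dotProduct x, smul_dotProduct, hzw, smul_zero, sub_zero]
  rw [star_trivial, sub_smul_vecMulVec_mulVec hz, hxw]
  exact hA.dotProduct_mulVec_nonneg w

theorem ker_sub_smul_vecMulVec (hA : A.IsSymm) (hz : A *ᵥ z = b) (hc : c * (b ⬝ᵥ z) = 1) :
    LinearMap.ker (A - c • vecMulVec b b).mulVecLin =
      LinearMap.ker A.mulVecLin ⊔ Submodule.span ℝ {z} := by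
  ext x
  simp only [Submodule.mem_sup, Submodule.mem_span_singleton, LinearMap.mem_ker, mulVecLin_apply,
    sub_smul_vecMulVec_mulVec hz]
  refine ⟨fun hx => ⟨_, hx, _, ⟨_, rfl⟩, sub_add_cancel _ _⟩, ?_⟩
  rintro ⟨k, hk, _, ⟨α, rfl⟩, rfl⟩
  have hbk : b ⬝ᵥ k = 0 := by rw [← hz, mulVec_dotProduct_of_isSymm hA, hk, dotProduct_zero]
  have hα : c * (b ⬝ᵥ (k + α • z)) = α := by
    rw [dotProduct_add, hbk, dotProduct_smul, smul_eq_mul]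
    linear_combination α * hc
  rw [hα, add_sub_cancel_right, hk]

end RankOneDowndate

theorem finrank_ker_dotProductBilin_add_one {n : Type*} [Fintype n] {z : n → ℝ} (hz : z ≠ 0) :
    Module.finrank ℝ (LinearMap.ker (dotProductBilin ℝ ℝ z)) + 1 = Fintype.card n := by
  have hne : dotProductBilin ℝ ℝ z ≠ 0 := fun h =>
    hz (dotProduct_self_eq_zero.1 (LinearMap.congr_fun h z))
  rw [Module.Dual.finrank_ker_add_one_of_ne_zero hne, Module.finrank_fintype_fun_eq_card]

section MoorePenrose

namespace IsMoorePenroseInverse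

variable {m n : Type*} [Fintype m] [Fintype n] {A : Matrix m n ℝ} {B : Matrix n m ℝ}

theorem transpose (h : IsMoorePenroseInverse A B) : IsMoorePenroseInverse Aᵀ Bᵀ where
  mul_mul_self := by rw [← transpose_mul, ← transpose_mul, ← Matrix.mul_assoc, h.mul_mul_self]
  self_mul_mul := by rw [← transpose_mul, ← transpose_mul, ← Matrix.mul_assoc, h.self_mul_mul]
  symm_left := by rw [← transpose_mul, h.symm_right, h.symm_right]
  symm_right := by rw [← transpose_mul, h.symm_left, h.symm_left]

theorem isSymm {A B : Matrix n n ℝ} (h : IsMoorePenroseInverse A B) (hA : A.IsSymm) : B.IsSymm :=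
  IsMoorePenroseInverse.unique (hA.eq ▸ h.transpose) h

theorem mulVec_eq_zero (h : IsMoorePenroseInverse A B) {k : m → ℝ} (hk : Aᵀ *ᵥ k = 0) :
    B *ᵥ k = 0 := by
  rw [← h.self_mul_mul, Matrix.mul_assoc, ← h.symm_left, transpose_mul, ← mulVec_mulVec,
    ← mulVec_mulVec, hk, mulVec_zero, mulVec_zero]

theorem mulVec_mulVec_of_orthogonal (h : IsMoorePenroseInverse A B) {b : m → ℝ}
    (hb : ∀ k, Aᵀ *ᵥ k = 0 → k ⬝ᵥ b = 0) : A *ᵥ (B *ᵥ b) = b := by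
  set r := b - A *ᵥ (B *ᵥ b) with hr
  have hAAB : Aᵀ * (A * B) = Aᵀ := by rw [← h.symm_left, ← transpose_mul, h.mul_mul_self]
  have hAr : Aᵀ *ᵥ r = 0 := by
    rw [hr, mulVec_sub, mulVec_mulVec, mulVec_mulVec, Matrix.mul_assoc, hAAB, sub_self]
  have hrr : r ⬝ᵥ r = 0 := by
    nth_rw 2 [hr]
    rw [dotProduct_sub, hb r hAr, dotProduct_mulVec, ← mulVec_transpose, hAr, zero_dotProduct,
      sub_zero]
  exact (sub_eq_zero.1 (dotProduct_self_eq_zero.1 hrr)).symm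

end IsMoorePenroseInverse

theorem isMoorePenroseInverse_moorePenroseInverse {n : Type*} [Fintype n] {A : Matrix n n ℝ}
    (hA : A.IsSymm) : IsMoorePenroseInverse A (moorePenroseInverse hA) :=
  (exists_isMoorePenroseInverse hA).choose_spec

end MoorePenrose

section Walks

variable {V : Type*} {G : SimpleGraph V} {u v : V}

theorem eq_of_reachable_of_forall_adj_eq {α : Type*} {f : V → α}
    (hf : ∀ a b, G.Adj a b → f a = f b) (huv : G.Reachable u v) : f u = f v := by
  obtain ⟨p⟩ := huv
  induction p with
  | nil => rfl
  | cons h _ ih => exact (hf _ _ h).trans ih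

theorem reachable_deleteEdges_edge_of_mem_darts {p : G.Walk u v} (hp : p.IsTrail) {d : G.Dart}
    (hd : d ∈ p.darts) : (G.deleteEdges {d.edge}).Reachable u d.fst ∧
      (G.deleteEdges {d.edge}).Reachable d.snd v := by
  induction p with
  | nil => simp at hd
  | @cons a b _ h q ih =>
    rw [SimpleGraph.Walk.isTrail_cons] at hp
    rw [SimpleGraph.Walk.darts_cons, List.mem_cons] at hd
    rcases hd with rfl | hd
    · exact ⟨.rfl, ⟨q.toDeleteEdge _ hp.2⟩⟩
    · have hne : s(a, b) ≠ d.edge := fun heq =>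
        hp.2 (heq ▸ List.mem_map_of_mem hd)
      have hadj : (G.deleteEdges {d.edge}).Adj a b := SimpleGraph.deleteEdges_adj.2 ⟨h, hne⟩
      exact ⟨hadj.reachable.trans (ih hp.1 hd).1, (ih hp.1 hd).2⟩

theorem pairwise_support_of_forall_mem_darts_lt {α : Type*} [Preorder α] {f : V → α}
    {p : G.Walk u v} (hf : ∀ d ∈ p.darts, f d.snd < f d.fst) :
    p.support.Pairwise fun a b => f b < f a := by
  induction p with
  | nil => simp
  | @cons a b _ h q ih =>
    rw [SimpleGraph.Walk.darts_cons, List.forall_mem_cons] at hf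
    have hq := ih hf.2
    refine List.pairwise_cons.2 ⟨fun c hc => ?_, hq⟩
    rw [← SimpleGraph.Walk.cons_tail_support] at hc hq
    rcases List.mem_cons.1 hc with rfl | hc
    · exact hf.1
    · exact (List.rel_of_pairwise_cons hq hc).trans hf.1

theorem exists_mem_support_reachable_deleteEdges (p : G.Walk u v) {i j : V}
    (hij : G.Reachable i j) (hj : j ∈ p.support) :
    ∃ k ∈ p.support, (G.deleteEdges p.edgeSet).Reachable i k := by
  obtain ⟨q⟩ := hij
  induction q with
  | nil => exact ⟨_, hj, .rfl⟩
  | @cons a b _ hab _ ih =>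
    by_cases hmem : s(a, b) ∈ p.edges
    · exact ⟨a, p.fst_mem_support_of_mem_edges hmem, .rfl⟩
    · obtain ⟨k, hk, hbk⟩ := ih hj
      have hadj : (G.deleteEdges p.edgeSet).Adj a b := SimpleGraph.deleteEdges_adj.2 ⟨hab, hmem⟩
      exact ⟨k, hk, hadj.reachable.trans hbk⟩

theorem isAcyclic_deleteEdges_of_forall_mem {e : Sym2 V}
    (he : ∀ D, IsCycleEdgeSet G D → e ∈ D) : (G.deleteEdges {e}).IsAcyclic := by
  intro a c hc
  have hle : G.deleteEdges {e} ≤ G := SimpleGraph.deleteEdges_le _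
  have hmem : e ∈ (c.mapLe hle).edgeSet := he _ ⟨a, c.mapLe hle, hc.mapLe hle, rfl⟩
  rw [SimpleGraph.Walk.edgeSet_mapLe_eq_edgeSet] at hmem
  simpa using c.edges_subset_edgeSet hmem

theorem isCycleEdgeSet_insert_of_isPath (huv : G.Adj u v) {p : (G.deleteEdges {s(u, v)}).Walk u v}
    (hp : p.IsPath) : IsCycleEdgeSet G (insert s(u, v) p.edgeSet) := by
  have hle : G.deleteEdges {s(u, v)} ≤ G := SimpleGraph.deleteEdges_le _
  refine ⟨v, .cons huv.symm (p.mapLe hle), ?_, ?_⟩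
  · rw [SimpleGraph.Walk.cons_isCycle_iff]
    refine ⟨hp.mapLe hle, fun hmem => ?_⟩
    rw [SimpleGraph.Walk.edges_mapLe_eq_edges] at hmem
    exact (SimpleGraph.deleteEdges_adj.1 (p.edges_subset_edgeSet hmem)).2 Sym2.eq_swap
  · rw [SimpleGraph.Walk.edgeSet_cons, SimpleGraph.Walk.edgeSet_mapLe_eq_edgeSet,
      Sym2.eq_swap (a := v)]

theorem exists_isPath_of_unique_cycle {C : Set (Sym2 V)}
    (hC : ∀ D, IsCycleEdgeSet G D → D = C) (huv : G.Adj u v)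
    (hconn : (G.deleteEdges {s(u, v)}).Connected) :
    (G.deleteEdges {s(u, v)}).IsTree ∧ ∃ p : (G.deleteEdges {s(u, v)}).Walk u v, p.IsPath ∧
      (G.deleteEdges {s(u, v)}).deleteEdges p.edgeSet = G.deleteEdges C := by
  obtain ⟨p, hp⟩ := hconn.exists_isPath u v
  have hC' : insert s(u, v) p.edgeSet = C := hC _ (isCycleEdgeSet_insert_of_isPath huv hp)
  refine ⟨⟨hconn, isAcyclic_deleteEdges_of_forall_mem fun D hD => ?_⟩, p, hp, ?_⟩
  · rw [hC D hD, ← hC']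
    exact Set.mem_insert _ _
  · rw [SimpleGraph.deleteEdges_deleteEdges, ← Set.insert_eq, hC']

end Walks

section EdgeLaplacian

theorem mul_diagonal_mul_transpose_eq_sum {m n α : Type*} [Fintype n] [DecidableEq n]
    [CommSemiring α] (E : Matrix m n α) (w : n → α) :
    E * diagonal w * Eᵀ = ∑ e, w e • vecMulVec (E.col e) (E.col e) := by
  ext i j
  rw [Matrix.mul_apply, Matrix.sum_apply]
  simp only [mul_diagonal, transpose_apply, Matrix.smul_apply, vecMulVec_apply, col_apply,
    smul_eq_mul]
  exact Finset.sum_congr rfl fun e _ => by ring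

variable {V : Type*} [DecidableEq V]

/-- The Laplacian `(e_a - e_b)(e_a - e_b)ᵀ` of the graph whose only edge is `s(a, b)`, with
weight one: the Laplacian of a weighted graph is the weighted sum of these over its edges. -/
def edgeLaplacian : Sym2 V → Matrix V V ℝ :=
  Sym2.lift ⟨fun a b =>
    vecMulVec (Pi.single a 1 - Pi.single b 1) (Pi.single a 1 - Pi.single b 1), fun a b => by
      dsimp only
      rw [← neg_sub (Pi.single b (1 : ℝ) : V → ℝ), neg_vecMulVec, vecMulVec_neg, neg_neg]⟩

theorem edgeLaplacian_mk (a b : V) : edgeLaplacian s(a, b) =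
    vecMulVec (Pi.single a 1 - Pi.single b 1) (Pi.single a 1 - Pi.single b 1) := rfl

theorem edgeLaplacian_posSemidef [Finite V] (e : Sym2 V) : (edgeLaplacian e).PosSemidef := by
  induction e with | h a b => exact posSemidef_vecMulVec_self_star _

variable [Fintype V]

theorem edgeLaplacian_mk_mulVec (a b : V) (x : V → ℝ) :
    edgeLaplacian s(a, b) *ᵥ x = (x a - x b) • (Pi.single a 1 - Pi.single b 1) := by
  rw [edgeLaplacian_mk, vecMulVec_mulVec, op_smul_eq_smul, sub_dotProduct, single_one_dotProduct,
    single_one_dotProduct]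

theorem dotProduct_edgeLaplacian_mk_mulVec (a b : V) (x y : V → ℝ) :
    y ⬝ᵥ (edgeLaplacian s(a, b) *ᵥ x) = (y a - y b) * (x a - x b) := by
  rw [edgeLaplacian_mk_mulVec, dotProduct_smul, dotProduct_sub, dotProduct_single_one,
    dotProduct_single_one, smul_eq_mul, mul_comm]

end EdgeLaplacian

namespace WeightedGraph

variable {V : Type*}

section Laplacian

theorem incidence_col [DecidableEq V] (G : WeightedGraph V) (e : G.graph.edgeSet) :
    G.incidence.col e =
      Pi.single (Quot.out (e : Sym2 V)).1 1 - Pi.single (Quot.out (e : Sym2 V)).2 1 := by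
  have hout : s((Quot.out (e : Sym2 V)).1, (Quot.out (e : Sym2 V)).2) = e := Quot.out_eq _
  have hne : (Quot.out (e : Sym2 V)).1 ≠ (Quot.out (e : Sym2 V)).2 :=
    G.graph.ne_of_adj (SimpleGraph.mem_edgeSet _ |>.1 (hout.symm ▸ e.2))
  ext i
  simp only [incidence, col_apply, of_apply, Pi.sub_apply, Pi.single_apply]
  split_ifs with hfst hsnd
  · exact absurd (hfst.symm.trans hsnd) hne
  all_goals norm_num

variable [Fintype V]

theorem laplacian_eq_sum [DecidableEq V] (G : WeightedGraph V) [Fintype G.graph.edgeSet] :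
    G.laplacian = ∑ e ∈ G.graph.edgeFinset, G.weight e • edgeLaplacian e := by
  classical
  have hedge (e : G.graph.edgeSet) :
      edgeLaplacian (e : Sym2 V) = vecMulVec (G.incidence.col e) (G.incidence.col e) := by
    rw [incidence_col, ← edgeLaplacian_mk]
    exact congrArg edgeLaplacian (Quot.out_eq (e : Sym2 V)).symm
  have hfactor : G.laplacian =
      G.incidence * diagonal (fun e : G.graph.edgeSet => G.weight e) * G.incidenceᵀ := by
    unfold laplacian
    congr!
  rw [hfactor, mul_diagonal_mul_transpose_eq_sum,
    Finset.sum_subtype (F := inferInstance) _ fun _ => SimpleGraph.mem_edgeFinset]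
  simp only [hedge]

theorem laplacian_mulVec_one (G : WeightedGraph V) : G.laplacian *ᵥ 1 = 0 := by
  classical
  rw [laplacian_eq_sum, sum_mulVec]
  refine Finset.sum_eq_zero fun e _ => ?_
  induction e with | h a b => simp [smul_mulVec, edgeLaplacian_mk_mulVec]

theorem laplacian_posSemidef {G : WeightedGraph V} (hG : ∀ e ∈ G.graph.edgeSet, 0 < G.weight e) :
    G.laplacian.PosSemidef := by
  classical
  rw [laplacian_eq_sum]
  exact posSemidef_sum _ fun e he =>
    (edgeLaplacian_posSemidef e).smul (hG e (SimpleGraph.mem_edgeFinset.1 he)).le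

theorem eq_of_adj_of_laplacian_mulVec_eq_zero {G : WeightedGraph V}
    (hG : ∀ e ∈ G.graph.edgeSet, 0 < G.weight e) {x : V → ℝ} (hx : G.laplacian *ᵥ x = 0) {a b : V}
    (hab : G.graph.Adj a b) : x a = x b := by
  classical
  have hsum : ∑ e ∈ G.graph.edgeFinset, G.weight e * (x ⬝ᵥ (edgeLaplacian e *ᵥ x)) = 0 := by
    rw [← dotProduct_zero x, ← hx, laplacian_eq_sum, sum_mulVec, dotProduct_sum]
    simp only [smul_mulVec, dotProduct_smul, smul_eq_mul]
  have hterm : G.weight s(a, b) * (x ⬝ᵥ (edgeLaplacian s(a, b) *ᵥ x)) = 0 :=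
    (Finset.sum_eq_zero_iff_of_nonneg fun e he =>
      mul_nonneg (hG e (SimpleGraph.mem_edgeFinset.1 he)).le
        ((edgeLaplacian_posSemidef e).dotProduct_mulVec_nonneg x)).1 hsum _
      (SimpleGraph.mem_edgeFinset.2 hab)
  rw [dotProduct_edgeLaplacian_mk_mulVec] at hterm
  simpa [(hG s(a, b) hab).ne', sub_eq_zero] using hterm

theorem ker_laplacian_eq_span_one {G : WeightedGraph V}
    (hG : ∀ e ∈ G.graph.edgeSet, 0 < G.weight e) (hconn : G.graph.Connected) :
    LinearMap.ker G.laplacian.mulVecLin = Submodule.span ℝ {1} := by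
  refine le_antisymm (fun x hx => ?_) ?_
  · have hadj (a b : V) (hab : G.graph.Adj a b) : x a = x b :=
      eq_of_adj_of_laplacian_mulVec_eq_zero hG (LinearMap.mem_ker.1 hx) hab
    obtain ⟨u⟩ := hconn.nonempty
    refine Submodule.mem_span_singleton.2 ⟨x u, funext fun i => ?_⟩
    simpa using eq_of_reachable_of_forall_adj_eq hadj (hconn u i)
  · rw [Submodule.span_singleton_le_iff_mem, LinearMap.mem_ker, mulVecLin_apply,
      laplacian_mulVec_one]

theorem exists_isConsensusTrajectory (G : WeightedGraph V) (x₀ : V → ℝ) :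
    ∃ x, G.IsConsensusTrajectory x ∧ x 0 = x₀ := by
  obtain ⟨x, hx, hx₀⟩ :=
    exists_isIntegralCurve_continuousLinearMap (-G.laplacian.mulVecLin).toContinuousLinearMap x₀
  exact ⟨x, hx.isIntegralCurveOn _, hx₀⟩

open Classical in
/-- Testing the Laplacian against the indicator of one side of a bridge leaves only the flow
through the bridge. -/
theorem indicator_dotProduct_laplacian_mulVec_of_isBridge (G : WeightedGraph V) {a b : V}
    (hab : G.graph.Adj a b) (hbridge : G.graph.IsBridge s(a, b)) (x : V → ℝ) :
    ({i | (G.graph.deleteEdges {s(a, b)}).Reachable a i}.indicator 1) ⬝ᵥ (G.laplacian *ᵥ x) =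
      G.weight s(a, b) * (x a - x b) := by
  rw [laplacian_eq_sum, sum_mulVec, dotProduct_sum, Finset.sum_eq_single s(a, b)]
  · rw [SimpleGraph.isBridge_iff] at hbridge
    simp [smul_mulVec, dotProduct_edgeLaplacian_mk_mulVec, hbridge]
  · intro e he hne
    induction e with | h c d =>
    have hadj : (G.graph.deleteEdges {s(a, b)}).Adj c d :=
      SimpleGraph.deleteEdges_adj.2 ⟨SimpleGraph.mem_edgeFinset.1 he, hne⟩
    have hside : (G.graph.deleteEdges {s(a, b)}).Reachable a c ↔
        (G.graph.deleteEdges {s(a, b)}).Reachable a d :=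
      ⟨fun h => h.trans hadj.reachable, fun h => h.trans hadj.symm.reachable⟩
    simp [smul_mulVec, dotProduct_edgeLaplacian_mk_mulVec, Set.indicator_apply, hside]
  · exact fun hmem => absurd (SimpleGraph.mem_edgeFinset.2 hab) hmem

end Laplacian

section UnitFlow

variable [Fintype V] [DecidableEq V] {G : WeightedGraph V} {u v : V} {z : V → ℝ}

theorem potential_eq_of_isBridge_of_reachable {a b : V} (hab : G.graph.Adj a b)
    (hbridge : G.graph.IsBridge s(a, b))
    (huv : (G.graph.deleteEdges {s(a, b)}).Reachable u v)
    (hz : G.laplacian *ᵥ z = Pi.single u 1 - Pi.single v 1) : z a = z b := by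
  classical
  have hcut := G.indicator_dotProduct_laplacian_mulVec_of_isBridge hab hbridge z
  have hside : (G.graph.deleteEdges {s(a, b)}).Reachable a u ↔
      (G.graph.deleteEdges {s(a, b)}).Reachable a v :=
    ⟨fun h => h.trans huv, fun h => h.trans huv.symm⟩
  rw [hz, dotProduct_sub, dotProduct_single_one, dotProduct_single_one] at hcut
  have hw : G.weight s(a, b) ≠ 0 := G.weight_ne_zero _ hab
  simpa [Set.indicator_apply, hside, hw, sub_eq_zero, eq_comm] using hcut

theorem weight_mul_potential_sub_of_isBridge {a b : V} (hab : G.graph.Adj a b)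
    (hbridge : G.graph.IsBridge s(a, b))
    (hu : (G.graph.deleteEdges {s(a, b)}).Reachable u a)
    (hv : (G.graph.deleteEdges {s(a, b)}).Reachable b v)
    (hz : G.laplacian *ᵥ z = Pi.single u 1 - Pi.single v 1) :
    G.weight s(a, b) * (z a - z b) = 1 := by
  classical
  have hav : ¬ (G.graph.deleteEdges {s(a, b)}).Reachable a v := fun h =>
    SimpleGraph.isBridge_iff.1 hbridge (h.trans hv.symm)
  rw [← G.indicator_dotProduct_laplacian_mulVec_of_isBridge hab hbridge, hz, dotProduct_sub,
    dotProduct_single_one, dotProduct_single_one]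
  simp [hu.symm, hav]

theorem potential_lt_of_mem_darts (hG : ∀ e ∈ G.graph.edgeSet, 0 < G.weight e)
    (hacyclic : G.graph.IsAcyclic) {p : G.graph.Walk u v} (hp : p.IsTrail)
    (hz : G.laplacian *ᵥ z = Pi.single u 1 - Pi.single v 1) {d : G.graph.Dart}
    (hd : d ∈ p.darts) : z d.snd < z d.fst := by
  obtain ⟨hu, hv⟩ := reachable_deleteEdges_edge_of_mem_darts hp hd
  have hbridge := SimpleGraph.isAcyclic_iff_forall_isBridge.1 hacyclic d.edge_mem
  have hflow := weight_mul_potential_sub_of_isBridge d.adj hbridge hu hv hz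
  exact sub_pos.1 (pos_of_mul_pos_right (hflow ▸ one_pos) (hG _ d.adj).le)

theorem injOn_potential_support (hG : ∀ e ∈ G.graph.edgeSet, 0 < G.weight e)
    (hacyclic : G.graph.IsAcyclic) {p : G.graph.Walk u v} (hp : p.IsTrail)
    (hz : G.laplacian *ᵥ z = Pi.single u 1 - Pi.single v 1) :
    Set.InjOn z {i | i ∈ p.support} := by
  have hdecr := pairwise_support_of_forall_mem_darts_lt fun d hd =>
    potential_lt_of_mem_darts hG hacyclic hp hz (d := d) hd
  have hnodup : (p.support.map z).Nodup := List.pairwise_map.2 (hdecr.imp fun h => h.ne')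
  exact fun i hi j hj => List.inj_on_of_nodup_map hnodup hi hj

theorem isClusteredBy_potential (hG : ∀ e ∈ G.graph.edgeSet, 0 < G.weight e)
    (htree : G.graph.IsTree) {p : G.graph.Walk u v} (hp : p.IsTrail)
    (hz : G.laplacian *ᵥ z = Pi.single u 1 - Pi.single v 1) :
    IsClusteredBy (G.graph.deleteEdges p.edgeSet) z := by
  have hadj (a b : V) (hab : (G.graph.deleteEdges p.edgeSet).Adj a b) : z a = z b := by
    obtain ⟨hab, hmem⟩ := SimpleGraph.deleteEdges_adj.1 hab
    exact potential_eq_of_isBridge_of_reachable hab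
      (SimpleGraph.isAcyclic_iff_forall_isBridge.1 htree.isAcyclic hab)
      ⟨p.toDeleteEdge _ hmem⟩ hz
  intro i j
  rw [SimpleGraph.ConnectedComponent.eq]
  refine ⟨fun hij => ?_, eq_of_reachable_of_forall_adj_eq hadj⟩
  obtain ⟨k, hk, hik⟩ :=
    exists_mem_support_reachable_deleteEdges p (htree.connected i u) p.start_mem_support
  obtain ⟨l, hl, hjl⟩ :=
    exists_mem_support_reachable_deleteEdges p (htree.connected j u) p.start_mem_support
  have hkl : k = l := injOn_potential_support hG htree.isAcyclic hp hz hk hl <| by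
    rw [← eq_of_reachable_of_forall_adj_eq hadj hik, hij, eq_of_reachable_of_forall_adj_eq hadj hjl]
  exact hik.trans (hkl ▸ hjl.symm)

/-- The potential `L(G)† (e_u - e_v)` of a unit flow from `u` to `v`; the pseudo-inverse normalizes
it to have zero sum. -/
noncomputable def potential (G : WeightedGraph V) (u v : V) : V → ℝ :=
  moorePenroseInverse G.laplacian_isSymm *ᵥ (Pi.single u 1 - Pi.single v 1)

theorem laplacian_mulVec_potential (hG : ∀ e ∈ G.graph.edgeSet, 0 < G.weight e)
    (hconn : G.graph.Connected) (u v : V) :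
    G.laplacian *ᵥ G.potential u v = Pi.single u 1 - Pi.single v 1 := by
  refine (isMoorePenroseInverse_moorePenroseInverse _).mulVec_mulVec_of_orthogonal fun k hk => ?_
  have hspan : k ∈ Submodule.span ℝ {1} := by
    rwa [← ker_laplacian_eq_span_one hG hconn, LinearMap.mem_ker, mulVecLin_apply,
      ← G.laplacian_isSymm.eq]
  obtain ⟨c, rfl⟩ := Submodule.mem_span_singleton.1 hspan
  simp

theorem one_dotProduct_potential (G : WeightedGraph V) (u v : V) : 1 ⬝ᵥ G.potential u v = 0 := by
  have hMP := isMoorePenroseInverse_moorePenroseInverse G.laplacian_isSymm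
  have hone : moorePenroseInverse G.laplacian_isSymm *ᵥ 1 = 0 :=
    hMP.mulVec_eq_zero (by rw [G.laplacian_isSymm.eq, laplacian_mulVec_one])
  rw [potential, ← mulVec_dotProduct_of_isSymm (hMP.isSymm G.laplacian_isSymm), hone,
    zero_dotProduct]

theorem effectiveResistance_eq_dotProduct_potential (G : WeightedGraph V) (u v : V) :
    G.effectiveResistance u v = (Pi.single u 1 - Pi.single v 1) ⬝ᵥ G.potential u v := by
  have hMP := isMoorePenroseInverse_moorePenroseInverse G.laplacian_isSymm
  have hsymm := (hMP.isSymm G.laplacian_isSymm).apply u v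
  simp only [effectiveResistance, potential, mulVec_sub, mulVec_single_one, sub_dotProduct,
    single_one_dotProduct, Pi.sub_apply, col_apply, hsymm]
  ring

end UnitFlow

section CriticalWeight

theorem positivePart_weight_pos (G : WeightedGraph V) :
    ∀ e ∈ G.positivePart.graph.edgeSet, 0 < G.positivePart.weight e := by
  intro e he
  rw [positivePart, SimpleGraph.edgeSet_deleteEdges] at he
  exact (not_lt.1 he.2).lt_of_ne' (G.weight_ne_zero e he.1)

variable {G : WeightedGraph V} {u v : V}

theorem positivePart_graph_eq_deleteEdges (hneg : G.weight s(u, v) < 0)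
    (huniq : ∀ e ∈ G.graph.edgeSet, G.weight e < 0 → e = s(u, v)) :
    G.positivePart.graph = G.graph.deleteEdges {s(u, v)} := by
  ext a b
  simp only [positivePart, SimpleGraph.deleteEdges_adj, Set.mem_ofPred_eq, Set.mem_singleton_iff]
  exact and_congr_right fun hab => not_congr ⟨huniq _ hab, fun h => h ▸ hneg⟩

variable [Fintype V] [DecidableEq V]

theorem laplacian_eq_positivePart_laplacian_sub (huv : G.graph.Adj u v)
    (hneg : G.weight s(u, v) < 0)
    (huniq : ∀ e ∈ G.graph.edgeSet, G.weight e < 0 → e = s(u, v)) :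
    G.laplacian = G.positivePart.laplacian - |G.weight s(u, v)| •
      vecMulVec (Pi.single u 1 - Pi.single v 1) (Pi.single u 1 - Pi.single v 1) := by
  classical
  have hedges : G.positivePart.graph.edgeFinset = G.graph.edgeFinset.erase s(u, v) := by
    ext e
    simp [positivePart_graph_eq_deleteEdges hneg huniq, SimpleGraph.edgeSet_deleteEdges, and_comm]
  rw [laplacian_eq_sum, laplacian_eq_sum, hedges, ← edgeLaplacian_mk, abs_of_neg hneg, neg_smul,
    sub_neg_eq_add]
  exact (Finset.sum_erase_add _ _ (SimpleGraph.mem_edgeFinset.2 huv)).symm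

theorem abs_weight_mul_dotProduct_potential (huv : G.graph.Adj u v)
    (hweight : |G.weight s(u, v)| = (G.positivePart.effectiveResistance u v)⁻¹) :
    |G.weight s(u, v)| *
      ((Pi.single u 1 - Pi.single v 1) ⬝ᵥ G.positivePart.potential u v) = 1 := by
  have hR : G.positivePart.effectiveResistance u v = |G.weight s(u, v)|⁻¹ := by
    rw [hweight, inv_inv]
  rw [← effectiveResistance_eq_dotProduct_potential, hR,
    mul_inv_cancel₀ (abs_ne_zero.2 (G.weight_ne_zero _ huv))]

theorem isClusteredBy_deleteEdges_of_unique_cycle (hpos : G.positivePart.graph.Connected)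
    (huv : G.graph.Adj u v) (hneg : G.weight s(u, v) < 0)
    (huniq : ∀ e ∈ G.graph.edgeSet, G.weight e < 0 → e = s(u, v)) {C : Set (Sym2 V)}
    (hC : ∀ D, IsCycleEdgeSet G.graph D → D = C) {z : V → ℝ}
    (hz : G.positivePart.laplacian *ᵥ z = Pi.single u 1 - Pi.single v 1) :
    IsClusteredBy (G.graph.deleteEdges C) z := by
  have hgraph := positivePart_graph_eq_deleteEdges hneg huniq
  have hpath := exists_isPath_of_unique_cycle hC huv (hgraph ▸ hpos)
  rw [← hgraph] at hpath
  obtain ⟨htree, p, hp, hH⟩ := hpath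
  exact hH ▸ isClusteredBy_potential G.positivePart_weight_pos htree hp.isTrail hz

theorem IsConsensusTrajectory.tendsto_of_critical_weight
    (hpos : G.positivePart.graph.Connected) (huv : G.graph.Adj u v) (hneg : G.weight s(u, v) < 0)
    (huniq : ∀ e ∈ G.graph.edgeSet, G.weight e < 0 → e = s(u, v)) {z : V → ℝ}
    (hz : G.positivePart.laplacian *ᵥ z = Pi.single u 1 - Pi.single v 1) (hmean : 1 ⬝ᵥ z = 0)
    (hcrit : |G.weight s(u, v)| * ((Pi.single u 1 - Pi.single v 1) ⬝ᵥ z) = 1)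
    {x : ℝ → V → ℝ} (hx : G.IsConsensusTrajectory x) :
    Tendsto x atTop
      (𝓝 fun i => (∑ j, x 0 j) / Fintype.card V + z ⬝ᵥ x 0 / (z ⬝ᵥ z) * z i) := by
  have hpsd : G.laplacian.PosSemidef := by
    rw [laplacian_eq_positivePart_laplacian_sub huv hneg huniq]
    exact posSemidef_sub_smul_vecMulVec (laplacian_posSemidef G.positivePart_weight_pos) hz hcrit
  have hker : LinearMap.ker G.laplacian.mulVecLin = Submodule.span ℝ {1, z} := by
    rw [laplacian_eq_positivePart_laplacian_sub huv hneg huniq,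
      ker_sub_smul_vecMulVec G.positivePart.laplacian_isSymm hz hcrit,
      ker_laplacian_eq_span_one G.positivePart_weight_pos hpos, Submodule.span_insert]
  convert tendsto_of_ker_eq_span_pair hpsd hmean hker hx using 2
  ext i
  simp [dotProduct_comm (x 0) z, dotProduct_one]

end CriticalWeight

end WeightedGraph

namespace IsClusteredBy

variable {V : Type*} {H : SimpleGraph V} {y : V → ℝ}

theorem const_add_mul (hy : IsClusteredBy H y) (β : ℝ) {α : ℝ} (hα : α ≠ 0) :
    IsClusteredBy H fun i => β + α * y i := fun i j => by
  rw [← hy i j, add_right_inj, mul_right_inj' hα]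

theorem ncard_range (hy : IsClusteredBy H y) :
    (Set.range y).ncard = Nat.card H.ConnectedComponent := by
  let f : H.ConnectedComponent → ℝ :=
    Quot.lift y fun i j h => (hy i j).2 (SimpleGraph.ConnectedComponent.eq.2 h)
  have hf : Function.Injective f := by
    rintro ⟨i⟩ ⟨j⟩ h
    exact (hy i j).1 h
  have hrange : Set.range f = Set.range y := Set.range_quot_lift _
  rw [← hrange, ← Nat.card_coe_set_eq, Nat.card_range_of_injective hf]

end IsClusteredBy

theorem mainTheorem6 {V : Type*} [Fintype V] (G : WeightedGraph V)
    (hconn : G.graph.Connected)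
    -- `C` is the edge set of the only cycle of `G`
    (C : Set (Sym2 V)) (hC : IsCycleEdgeSet G.graph C)
    (hCuniq : ∀ D, IsCycleEdgeSet G.graph D → D = C)
    (hpos : G.positivePart.graph.Connected)
    -- `s(u, v)` is the only edge with negative weight
    (u v : V) (huv : G.graph.Adj u v) (hneg : G.weight s(u, v) < 0)
    (hneg_uniq : ∀ e ∈ G.graph.edgeSet, G.weight e < 0 → e = s(u, v))
    (hweight : |G.weight s(u, v)| = (G.positivePart.effectiveResistance u v)⁻¹) :
    -- every initial condition has a trajectory
    (∀ x₀ : V → ℝ, ∃ x : ℝ → V → ℝ, G.IsConsensusTrajectory x ∧ x 0 = x₀) ∧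
    -- the hyperplane `N` of degenerate initial conditions
    ∃ N : Submodule ℝ (V → ℝ), Module.finrank ℝ N + 1 = Fintype.card V ∧
      ∀ x : ℝ → V → ℝ, G.IsConsensusTrajectory x →
        ∃ y : V → ℝ, Filter.Tendsto x Filter.atTop (nhds y) ∧
          -- for any initial condition, agreement on each component left by deleting the cycle edges
          (∀ i j, (G.graph.deleteEdges C).Reachable i j → y i = y j) ∧
          -- outside `N`, the components are the clusters, and there are `q` of them
          (x 0 ∉ N → IsClusteredBy (G.graph.deleteEdges C) y ∧
            (Set.range y).ncard = Nat.card (G.graph.deleteEdges C).ConnectedComponent) ∧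
          -- on `N`, all agents agree, on the average of the initial states
          (x 0 ∈ N → ∀ i, y i = (∑ j, x 0 j) / Fintype.card V) := by
  classical
  obtain ⟨z, hz, hmean, hcrit⟩ : ∃ z : V → ℝ,
      G.positivePart.laplacian *ᵥ z = Pi.single u 1 - Pi.single v 1 ∧ 1 ⬝ᵥ z = 0 ∧
        |G.weight s(u, v)| * ((Pi.single u 1 - Pi.single v 1) ⬝ᵥ z) = 1 :=
    ⟨G.positivePart.potential u v,
      WeightedGraph.laplacian_mulVec_potential G.positivePart_weight_pos hpos u v,
      G.positivePart.one_dotProduct_potential u v,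
      WeightedGraph.abs_weight_mul_dotProduct_potential huv hweight⟩
  have hclus : IsClusteredBy (G.graph.deleteEdges C) z :=
    WeightedGraph.isClusteredBy_deleteEdges_of_unique_cycle hpos huv hneg hneg_uniq hCuniq hz
  have hz_ne : z ≠ 0 := fun h => by simp [h] at hcrit
  refine ⟨G.exists_isConsensusTrajectory, LinearMap.ker (dotProductBilin ℝ ℝ z),
    finrank_ker_dotProductBilin_add_one hz_ne, fun x hx => ⟨_,
      hx.tendsto_of_critical_weight hpos huv hneg hneg_uniq hz hmean hcrit, ?_, ?_, ?_⟩⟩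
  · intro i j hij
    rw [(hclus i j).2 (SimpleGraph.ConnectedComponent.eq.2 hij)]
  · intro hx₀
    have hα : z ⬝ᵥ x 0 / (z ⬝ᵥ z) ≠ 0 := div_ne_zero hx₀ (mt dotProduct_self_eq_zero.1 hz_ne)
    have hy := hclus.const_add_mul ((∑ j, x 0 j) / Fintype.card V) hα
    exact ⟨hy, hy.ncard_range⟩
  · intro hx₀ i
    rw [show z ⬝ᵥ x 0 = 0 from hx₀, zero_div, zero_mul, add_zero]
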